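/- A residuated lattice is an algebra $\mathbf A=(A,\wedge,\vee,\cdot,\backslash,/,1)$ such that $(A,\wedge,\vee)$ is a lattice, $(A,\cdot,1)$ is a monoid, and $y\le x\backslash z \iff x\cdot y\le z \iff x\le z/y$ for all $x,y,z\in A$. It is idempotent if $x\cdot x=x$ for all $x$; conic if every element is comparable to $1$; a residuated chain if its order is total; semilinear if it is (isomorphic to) a subdirect product of residuated chains; semiconic if it belongs to the variety generated by the conic residuated lattices; and finitely subdirectly irreducible if $\Theta\cap\Psi=\Delta_A$ implies $\Theta=\Delta_A$ or $\Psi=\Delta_A$ for all congruences $\Theta,\Psi$ of $\mathbf A$, where $\Delta_A$ is the identity congruence. A class $\mathcal K$ of residuated lattices has the amalgamation property (AP) if for all $\mathbf A,\mathbf B,\mathbf C\in\mathcal K$ and all embeddings $f_B\colon\mathbf A\to\mathbf B$ and $f_C\colon\mathbf A\to\mathbf C$ there are $\mathbf D\in\mathcal K$ and embeddings $g_B\colon\mathbf B\to\mathbf D$ and $g_C\colon\mathbf C\to\mathbf D$ with $g_B\circ f_B=g_C\circ f_C$. It has the one-sided amalgamation property (1AP) if the same holds with $g_B$ required only to be a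 homomorphism (and $g_C$ still an embedding). For a variety $\mathcal V$ of residuated lattices let $\vdash_{\mathcal V}$ be the finitary consequence relation on formulas (terms in the language $\wedge,\vee,\cdot,\backslash,/,1$ over countably many variables) whose equivalent algebraic semantics is $\mathcal V$: $\Gamma\vdash_{\mathcal V}\varphi$ iff for some finite $\Gamma_0\subseteq\Gamma$, in every member of $\mathcal V$ and under every assignment, $1\le\varphi$ holds whenever $1\le\psi$ holds for all $\psi\in\Gamma_0$. Let $\mathbf{SIL}$ and $\mathbf{CIL}$ be the logics $\vdash_{\mathcal V}$ for $\mathcal V$ the variety of semilinear idempotent and of semiconic idempotent residuated lattices, respectively. A logic $\vdash$ has the deductive interpolation property if whenever $\Gamma\vdash\varphi$ there is a set of formulas $\Gamma'$ with $\mathrm{var}(\Gamma')\subseteq\mathrm{var}(\Gamma)\cap\mathrm{var}(\varphi)$, $\Gamma\vdash\psi$ for every $\psi\in\Gamma'$, and $\Gamma'\vdash\varphi$. Theorem. (1) The 1AP, and hence also the AP, fails for the class of idempotent residuated chains. (2) The 1AP, and hence also the AP, fails for the class of finitely subdirectly irreducible conic idempotent residuated lattices. (3) The AP fails for the variety of semilinear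 idempotent residuated lattices and for the variety of semiconic idempotent residuated lattices. (4) Neither $\mathbf{SIL}$ nor $\mathbf{CIL}$ has the deductive interpolation property. -/

import Mathlib

universe u

namespace ResLat

/-- A residuated lattice `(A, ⊓, ⊔, *, \, /, 1)`: a lattice and a monoid with residuals
`ldiv x z = x \ z` and `rdiv z y = z / y`. -/
class ResiduatedLattice (A : Type u) extends Lattice A, Monoid A where
  /-- `ldiv x z` is `x \ z`. -/
  ldiv : A → A → A
  /-- `rdiv z y` is `z / y`. -/
  rdiv : A → A → A
  le_ldiv_iff : ∀ x y z : A, y ≤ ldiv x z ↔ x * y ≤ z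
  le_rdiv_iff : ∀ x y z : A, x ≤ rdiv z y ↔ x * y ≤ z

/-- Homomorphisms of residuated lattices. -/
structure IsHom {A B : Type*} [ResiduatedLattice A] [ResiduatedLattice B] (f : A → B) : Prop where
  map_inf : ∀ x y, f (x ⊓ y) = f x ⊓ f y
  map_sup : ∀ x y, f (x ⊔ y) = f x ⊔ f y
  map_mul : ∀ x y, f (x * y) = f x * f y
  map_ldiv : ∀ x y, f (ResiduatedLattice.ldiv x y) = ResiduatedLattice.ldiv (f x) (f y)
  map_rdiv : ∀ x y, f (ResiduatedLattice.rdiv x y) = ResiduatedLattice.rdiv (f x) (f y)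
  map_one : f 1 = 1

/-- Embeddings are the injective homomorphisms. -/
def IsEmb {A B : Type*} [ResiduatedLattice A] [ResiduatedLattice B] (f : A → B) : Prop :=
  IsHom f ∧ Function.Injective f

/-- Congruences of a residuated lattice: equivalence relations compatible with all operations. -/
structure IsCongruence {A : Type*} [ResiduatedLattice A] (r : Setoid A) : Prop where
  inf : ∀ {x x' y y'}, r x x' → r y y' → r (x ⊓ y) (x' ⊓ y')
  sup : ∀ {x x' y y'}, r x x' → r y y' → r (x ⊔ y) (x' ⊔ y')
  mul : ∀ {x x' y y'}, r x x' → r y y' → r (x * y) (x' * y')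
  ldiv : ∀ {x x' y y'}, r x x' → r y y' →
    r (ResiduatedLattice.ldiv x y) (ResiduatedLattice.ldiv x' y')
  rdiv : ∀ {x x' y y'}, r x x' → r y y' →
    r (ResiduatedLattice.rdiv x y) (ResiduatedLattice.rdiv x' y')

/-! ### Classes of residuated lattices -/

/-- A class of residuated lattices (in a fixed universe). -/
abbrev RLClass : Type (u + 1) := ∀ (A : Type u) [ResiduatedLattice A], Prop

/-- The identity `x * x = x`. -/
def Idempotent (A : Type u) [ResiduatedLattice A] : Prop := ∀ x : A, x * x = x

/-- Every element is comparable to `1`. -/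
def Conic (A : Type u) [ResiduatedLattice A] : Prop := ∀ x : A, x ≤ 1 ∨ 1 ≤ x

/-- Totally ordered residuated lattices (residuated chains). -/
def Chain (A : Type u) [ResiduatedLattice A] : Prop := ∀ x y : A, x ≤ y ∨ y ≤ x

/-- Finitely subdirectly irreducible: the identity congruence is meet irreducible in the
lattice of congruences. -/
def FSI (A : Type u) [ResiduatedLattice A] : Prop :=
  ∀ r s : Setoid A, IsCongruence r → IsCongruence s → r ⊓ s = ⊥ → r = ⊥ ∨ s = ⊥

/-- Semilinear: (isomorphic to) a subdirect product of residuated chains. -/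
def Semilinear (A : Type u) [ResiduatedLattice A] : Prop :=
  ∃ (I : Type u) (B : I → Type u) (_ : ∀ i, ResiduatedLattice (B i)) (f : ∀ i, A → B i),
    (∀ i, Chain (B i)) ∧ (∀ i, IsHom (f i)) ∧ (∀ i, Function.Surjective (f i)) ∧
      ∀ x y : A, (∀ i, f i x = f i y) → x = y

/-- Terms in the language of residuated lattices over countably many variables; these are also
the formulas of the associated logics. -/
inductive Term : Type
  | var : ℕ → Term
  | one : Term
  | inf : Term → Term → Term
  | sup : Term → Term → Term
  | mul : Term → Term → Term
  | ldiv : Term → Term → Term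
  | rdiv : Term → Term → Term

/-- The value of a term under an assignment of the variables. -/
def Term.eval {A : Type u} [ResiduatedLattice A] (a : ℕ → A) : Term → A
  | .var n => a n
  | .one => 1
  | .inf s t => s.eval a ⊓ t.eval a
  | .sup s t => s.eval a ⊔ t.eval a
  | .mul s t => s.eval a * t.eval a
  | .ldiv s t => ResiduatedLattice.ldiv (s.eval a) (t.eval a)
  | .rdiv s t => ResiduatedLattice.rdiv (s.eval a) (t.eval a)

/-- The set of variables that occur in a term. -/
def Term.vars : Term → Set ℕ
  | .var n => {n}
  | .one => ∅
  | .inf s t => s.vars ∪ t.vars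
  | .sup s t => s.vars ∪ t.vars
  | .mul s t => s.vars ∪ t.vars
  | .ldiv s t => s.vars ∪ t.vars
  | .rdiv s t => s.vars ∪ t.vars

/-- The set of variables that occur in a set of terms. -/
def varsOf (Γ : Set Term) : Set ℕ := ⋃ t ∈ Γ, t.vars

/-- `A` satisfies the identity `s ≈ t`. -/
def Satisfies (A : Type u) [ResiduatedLattice A] (s t : Term) : Prop :=
  ∀ a : ℕ → A, s.eval a = t.eval a

/-- The variety (equational class) generated by a class `K`: all the residuated lattices that
satisfy every identity valid throughout `K`. -/
def GeneratedVariety (K : RLClass.{u}) : RLClass.{u} := fun A _ =>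
  ∀ s t : Term, (∀ (B : Type u) [ResiduatedLattice B], K B → Satisfies B s t) → Satisfies A s t

/-- Semiconic: in the variety generated by the conic residuated lattices. -/
def Semiconic (A : Type u) [ResiduatedLattice A] : Prop :=
  GeneratedVariety (fun B _ => Conic B) A

/-- The class of idempotent residuated chains. -/
def IdempotentChains : RLClass.{u} := fun A _ => Idempotent A ∧ Chain A

/-- The class of finitely subdirectly irreducible conic idempotent residuated lattices. -/
def FSIConicIdempotent : RLClass.{u} := fun A _ => FSI A ∧ Conic A ∧ Idempotent A

/-- The variety of semilinear idempotent residuated lattices. -/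
def SemilinearIdempotent : RLClass.{u} := fun A _ => Semilinear A ∧ Idempotent A

/-- The variety of semiconic idempotent residuated lattices. -/
def SemiconicIdempotent : RLClass.{u} := fun A _ => Semiconic A ∧ Idempotent A

/-! ### Amalgamation -/

/-- The amalgamation property: every V-formation in `K` has an amalgam in `K`. -/
def AmalgamationProperty (K : RLClass.{u}) : Prop :=
  ∀ (A B C : Type u) [ResiduatedLattice A] [ResiduatedLattice B] [ResiduatedLattice C],
    K A → K B → K C → ∀ (fB : A → B) (fC : A → C), IsEmb fB → IsEmb fC →
      ∃ (D : Type u) (_ : ResiduatedLattice D), K D ∧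
        ∃ (gB : B → D) (gC : C → D), IsEmb gB ∧ IsEmb gC ∧ gB ∘ fB = gC ∘ fC

/-- The one-sided amalgamation property: as the amalgamation property, but `gB` is only required
to be a homomorphism. -/
def OneSidedAmalgamationProperty (K : RLClass.{u}) : Prop :=
  ∀ (A B C : Type u) [ResiduatedLattice A] [ResiduatedLattice B] [ResiduatedLattice C],
    K A → K B → K C → ∀ (fB : A → B) (fC : A → C), IsEmb fB → IsEmb fC →
      ∃ (D : Type u) (_ : ResiduatedLattice D), K D ∧
        ∃ (gB : B → D) (gC : C → D), IsHom gB ∧ IsEmb gC ∧ gB ∘ fB = gC ∘ fC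

/-! ### Logics -/

/-- The logic whose equivalent algebraic semantics is `V`, a finitary consequence relation:
`φ` follows from `Γ` when for some finite `Δ ⊆ Γ`, in every member of `V` and for every
assignment, `φ` takes a value `≥ 1` whenever all members of `Δ` do. -/
def Entails (V : RLClass.{u}) (Γ : Set Term) (φ : Term) : Prop :=
  ∃ Δ : Set Term, Δ ⊆ Γ ∧ Δ.Finite ∧
    ∀ (A : Type u) [ResiduatedLattice A], V A → ∀ a : ℕ → A,
      (∀ ψ ∈ Δ, 1 ≤ ψ.eval a) → 1 ≤ φ.eval a

/-- Semilinear idempotent logic. -/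
def SIL : Set Term → Term → Prop := Entails SemilinearIdempotent.{u}

/-- Semiconic idempotent logic. -/
def CIL : Set Term → Term → Prop := Entails SemiconicIdempotent.{u}

/-- The deductive interpolation property of a consequence relation. -/
def DeductiveInterpolation (L : Set Term → Term → Prop) : Prop :=
  ∀ (Γ : Set Term) (φ : Term), L Γ φ →
    ∃ Γ' : Set Term, varsOf Γ' ⊆ varsOf Γ ∩ φ.vars ∧ (∀ ψ ∈ Γ', L Γ ψ) ∧ L Γ' φ

end ResLat

/-! One V-formation of finite idempotent chains, `LeftChain` and `RightChain` over `ThreeChain`,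
refutes all the properties. Write `z` for the common bottom. On the left, `b ≤ 1`, `(b \ 1) \ 1 ≤ z`
and `b \ z ≤ z`; on the right there is `y = c' ≥ 1`.

Suppose all this held in one idempotent chain. If `b * y ≤ 1`, then `b ≤ 1 / y`, so `(1 / y) \ z ≤ b
\ z ≤ z`. If `1 ≤ b * y`, idempotence gives `b \ 1 ≤ y`, so `y \ 1 ≤ (b \ 1) \ 1 ≤ z`. Hence `(1 /
y) \ z ≤ z` or `y \ 1 ≤ z`, a condition on `y` and `z` that is false in `RightChain`.

Beyond chains, the case split becomes the inequality `HasConicCover`. It holds in conic algebras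
and, being an identity, in the varieties too; `one_le_of_hasConicCover` runs the argument from it.
The conclusion mentions neither `b` nor the left algebra, which also defeats interpolation. -/

namespace ResLat

open ResiduatedLattice

/-! ### Residuation -/

section Basic

variable {A : Type*} [ResiduatedLattice A]

theorem mul_le_mul_of_le_right {x y : A} (z : A) (h : x ≤ y) : x * z ≤ y * z :=
  (le_rdiv_iff _ _ _).1 (h.trans ((le_rdiv_iff _ _ _).2 le_rfl))

theorem mul_le_mul_of_le_left {x y : A} (z : A) (h : x ≤ y) : z * x ≤ z * y :=
  (le_ldiv_iff _ _ _).1 (h.trans ((le_ldiv_iff _ _ _).2 le_rfl))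

theorem mul_ldiv_le (x z : A) : x * ldiv x z ≤ z := (le_ldiv_iff _ _ _).1 le_rfl

theorem rdiv_mul_le (z y : A) : rdiv z y * y ≤ z := (le_rdiv_iff _ _ _).1 le_rfl

theorem one_le_ldiv_iff {x y : A} : 1 ≤ ldiv x y ↔ x ≤ y := by
  rw [le_ldiv_iff, mul_one]

end Basic

/-- Every `u` is covered by its two cones: a left conjugate of `u ⊓ 1` and one of `1 / u ⊓ 1`
join to an element above `1`. -/
def HasConicCover (A : Type*) [ResiduatedLattice A] : Prop :=
  ∀ u b s : A, 1 ≤ ldiv b ((rdiv 1 u ⊓ 1) * b) ⊔ ldiv s ((u ⊓ 1) * s)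

theorem Conic.hasConicCover {A : Type u} [ResiduatedLattice A] (h : Conic A) :
    HasConicCover A := by
  intro u b s
  rcases h u with h | h
  · refine le_sup_of_le_left (one_le_ldiv_iff.2 ?_)
    rw [inf_eq_right.2 ((le_rdiv_iff _ _ _).2 (by rwa [one_mul])), one_mul]
  · refine le_sup_of_le_right (one_le_ldiv_iff.2 ?_)
    rw [inf_eq_right.2 h, one_mul]

/-- The inequality `1 ≤ t` is the identity `1 ⊓ t ≈ 1`, so it passes from the conic algebras to the
variety they generate. -/
theorem Semiconic.hasConicCover {A : Type u} [ResiduatedLattice A] (h : Semiconic A) :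
    HasConicCover A := by
  intro u b s
  have key := h (.inf .one (.sup
      (.ldiv (.var 1) (.mul (.inf (.rdiv .one (.var 0)) .one) (.var 1)))
      (.ldiv (.var 2) (.mul (.inf (.var 0) .one) (.var 2))))) .one
    (fun B _ hB a => inf_eq_left.2 (Conic.hasConicCover hB (a 0) (a 1) (a 2)))
    (fun n => if n = 0 then u else if n = 1 then b else s)
  exact inf_eq_left.1 key

theorem Chain.conic {A : Type u} [ResiduatedLattice A] (h : Chain A) : Conic A := fun x => h x 1

theorem Conic.semiconic {A : Type u} [ResiduatedLattice A] (h : Conic A) : Semiconic A :=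
  fun _ _ H => H A h

theorem Chain.semilinear {A : Type u} [ResiduatedLattice A] (h : Chain A) : Semilinear A :=
  ⟨PUnit, fun _ => A, fun _ => inferInstance, fun _ => id, fun _ => h,
    fun _ => ⟨fun _ _ => rfl, fun _ _ => rfl, fun _ _ => rfl, fun _ _ => rfl, fun _ _ => rfl, rfl⟩,
    fun _ => Function.surjective_id, fun _ _ h => h ⟨⟩⟩

theorem Semilinear.hasConicCover {A : Type u} [ResiduatedLattice A] (h : Semilinear A) :
    HasConicCover A := by
  obtain ⟨I, B, _, f, hB, hf, -, hinj⟩ := h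
  intro u b s
  refine inf_eq_left.1 (hinj _ _ fun i => ?_)
  simp only [(hf i).map_inf, (hf i).map_sup, (hf i).map_mul, (hf i).map_ldiv, (hf i).map_rdiv,
    (hf i).map_one]
  exact inf_eq_left.2 ((hB i).conic.hasConicCover _ _ _)

/-! ### Congruences and finite subdirect irreducibility -/

/-- If `a` and `b` are related, then `(a \ b) ⊓ 1` is related to `1`; when nothing strictly below
`1` is, this forces `a ≤ b`, and `b ≤ a` by symmetry. -/
theorem IsCongruence.exists_lt_one {A : Type u} [ResiduatedLattice A] {r : Setoid A}
    (hr : IsCongruence r) (hne : r ≠ ⊥) : ∃ x < 1, r x 1 := by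
  by_contra! H
  have le_of_rel : ∀ {a b : A}, r a b → a ≤ b := by
    intro a b hab
    have h1 : r (ResiduatedLattice.ldiv a b ⊓ 1) (ResiduatedLattice.ldiv b b ⊓ 1) :=
      hr.inf (hr.ldiv hab (r.refl b)) (r.refl 1)
    rw [inf_eq_right.2 (one_le_ldiv_iff.2 (le_refl b))] at h1
    by_contra hlt
    refine H _ (inf_le_right.lt_of_ne fun h => hlt ?_) h1
    exact one_le_ldiv_iff.1 (inf_eq_right.1 h)
  refine hne (Setoid.ext fun a b => ⟨fun h => le_antisymm (le_of_rel h) (le_of_rel (r.symm h)), ?_⟩)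
  rintro rfl
  exact r.refl a

theorem IsCongruence.rel_one_of_le {A : Type u} [ResiduatedLattice A] {r : Setoid A}
    (hr : IsCongruence r) {x y : A} (hx : r x 1) (hxy : x ≤ y) (hy : y ≤ 1) : r y 1 := by
  have h := hr.sup hx (r.refl y)
  rwa [sup_eq_right.2 hxy, sup_eq_left.2 hy] at h

/-- Classes of `1` are convex, so of two elements below `1`, one collapsed by each congruence, the
larger is collapsed by both. -/
theorem Chain.fsi {A : Type u} [ResiduatedLattice A] (h : Chain A) : FSI A := by
  intro r s hr hs hrs
  by_contra! hne
  obtain ⟨x, hx, hrx⟩ := hr.exists_lt_one hne.1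
  obtain ⟨y, hy, hsy⟩ := hs.exists_lt_one hne.2
  have meet : ∀ w : A, r w 1 → s w 1 → w = 1 := by
    intro w h1 h2
    have : (r ⊓ s) w 1 := ⟨h1, h2⟩
    rwa [hrs] at this
  rcases h x y with hxy | hxy
  · exact hy.ne (meet y (hr.rel_one_of_le hrx hxy hy.le) hsy)
  · exact hx.ne (meet x hrx (hs.rel_one_of_le hsy hxy hx.le))

/-- If `b` satisfies the relations that make it collapse everything to `z`, then every `y ≥ 1`
is subject to a disjunction in `y` and `z` alone. -/
theorem one_le_of_hasConicCover {D : Type*} [ResiduatedLattice D] (hidem : ∀ x : D, x * x = x)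
    (hcover : HasConicCover D) {b z y : D} (hb : b ≤ 1) (hs : ldiv (ldiv b 1) 1 ≤ z)
    (hbz : ldiv b z ≤ z) (hy : 1 ≤ y) :
    1 ≤ rdiv z (ldiv (rdiv 1 y) z) ⊔ rdiv z (ldiv y 1) := by
  -- The split is on `b * y` against `1`. Conjugating by `b` and by `b \ 1` lets each case be tested
  -- after multiplying on the left by that element, where `b \ z ≤ z` and `(b \ 1) \ 1 ≤ z` apply.
  refine (hcover (b * y) b (ldiv b 1)).trans (sup_le_sup ?_ ?_)
  · -- the cone of `1 / (b * y)`
    set q := rdiv 1 (b * y) ⊓ 1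
    have h1 : q * b ≤ rdiv 1 y := by
      rw [le_rdiv_iff, mul_assoc]
      exact (mul_le_mul_of_le_right _ inf_le_left).trans (rdiv_mul_le _ _)
    rw [le_rdiv_iff]
    refine le_trans ((le_ldiv_iff _ _ _).2 ?_) hbz
    rw [← mul_assoc]
    exact (mul_le_mul_of_le_right _ ((mul_ldiv_le _ _).trans h1)).trans (mul_ldiv_le _ _)
  · -- the cone of `b * y`
    set s := ldiv b 1
    set p := b * y ⊓ 1
    have hs1 : 1 ≤ s := (le_ldiv_iff _ _ _).2 (by rwa [mul_one])
    have hbs : b * s ≤ b := by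
      have := mul_le_mul_of_le_left b (mul_ldiv_le b 1)
      rwa [← mul_assoc, hidem, mul_one] at this
    have hp : p ≤ b * (s * y) := by
      refine inf_le_left.trans (mul_le_mul_of_le_left _ ?_)
      simpa using mul_le_mul_of_le_right y hs1
    -- This replaces `b \ 1 ≤ y`: the factor `s * y` is produced twice, merged by idempotence, and
    -- `s` is absorbed by `b`.
    have hps : p * s ≤ y := calc
      p * s ≤ p * (s * y) := mul_le_mul_of_le_left _ (by simpa using mul_le_mul_of_le_left s hy)
      _ ≤ b * (s * y) * (s * y) := mul_le_mul_of_le_right _ hp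
      _ = b * s * y := by rw [mul_assoc, hidem, mul_assoc]
      _ ≤ b * y := mul_le_mul_of_le_right _ hbs
      _ ≤ y := by simpa using mul_le_mul_of_le_right y hb
    rw [le_rdiv_iff]
    refine le_trans ((le_ldiv_iff _ _ _).2 ?_) hs
    rw [← mul_assoc]
    exact (mul_le_mul_of_le_right _ ((mul_ldiv_le _ _).trans hps)).trans (mul_ldiv_le _ _)

/-! ### Terms, homomorphisms and embeddings -/

theorem IsHom.map_eval {A B : Type*} [ResiduatedLattice A] [ResiduatedLattice B] {f : A → B}
    (hf : IsHom f) (a : ℕ → A) (t : Term) : f (t.eval a) = t.eval (f ∘ a) := by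
  induction t with
  | var n => rfl
  | one => exact hf.map_one
  | inf s t hs ht => simp only [Term.eval, hf.map_inf, hs, ht]
  | sup s t hs ht => simp only [Term.eval, hf.map_sup, hs, ht]
  | mul s t hs ht => simp only [Term.eval, hf.map_mul, hs, ht]
  | ldiv s t hs ht => simp only [Term.eval, hf.map_ldiv, hs, ht]
  | rdiv s t hs ht => simp only [Term.eval, hf.map_rdiv, hs, ht]

theorem Term.eval_congr {A : Type*} [ResiduatedLattice A] {a a' : ℕ → A} (t : Term)
    (h : ∀ n ∈ t.vars, a n = a' n) : t.eval a = t.eval a' := by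
  induction t with
  | var n => exact h n rfl
  | one => rfl
  | inf s t hs ht | sup s t hs ht | mul s t hs ht | ldiv s t hs ht | rdiv s t hs ht =>
    simp only [Term.eval, hs fun n hn => h n (Or.inl hn), ht fun n hn => h n (Or.inr hn)]

theorem IsHom.monotone {A B : Type*} [ResiduatedLattice A] [ResiduatedLattice B] {f : A → B}
    (hf : IsHom f) {x y : A} (h : x ≤ y) : f x ≤ f y := by
  rw [← inf_eq_left, ← hf.map_inf, inf_eq_left.2 h]

theorem IsEmb.le_iff {A B : Type*} [ResiduatedLattice A] [ResiduatedLattice B] {f : A → B}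
    (hf : IsEmb f) {x y : A} : f x ≤ f y ↔ x ≤ y :=
  ⟨fun h => inf_eq_left.1 (hf.2 (by rw [hf.1.map_inf, inf_eq_left.2 h])), hf.1.monotone⟩

/-! ### Copies in higher universes -/

instance {A : Type} [ResiduatedLattice A] : ResiduatedLattice (ULift.{u} A) where
  inf x y := ⟨x.down ⊓ y.down⟩
  sup x y := ⟨x.down ⊔ y.down⟩
  inf_le_left x y := inf_le_left (a := x.down) (b := y.down)
  inf_le_right x y := inf_le_right (a := x.down) (b := y.down)
  le_inf _ _ _ h h' := le_inf (α := A) h h'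
  le_sup_left x y := le_sup_left (a := x.down) (b := y.down)
  le_sup_right x y := le_sup_right (a := x.down) (b := y.down)
  sup_le x y z := sup_le (a := x.down) (b := y.down) (c := z.down)
  mul x y := ⟨x.down * y.down⟩
  one := ⟨1⟩
  mul_assoc x y z := congrArg ULift.up (mul_assoc x.down y.down z.down)
  one_mul x := congrArg ULift.up (one_mul x.down)
  mul_one x := congrArg ULift.up (mul_one x.down)
  npow n x := ⟨x.down ^ n⟩
  npow_zero x := congrArg ULift.up (pow_zero x.down)
  npow_succ n x := congrArg ULift.up (pow_succ x.down n)
  ldiv x y := ⟨ldiv x.down y.down⟩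
  rdiv x y := ⟨rdiv x.down y.down⟩
  le_ldiv_iff x y z := le_ldiv_iff x.down y.down z.down
  le_rdiv_iff x y z := le_rdiv_iff x.down y.down z.down

theorem IsEmb.ulift {A B : Type} [ResiduatedLattice A] [ResiduatedLattice B] {f : A → B}
    (hf : IsEmb f) : IsEmb (ULift.map f : ULift.{u} A → ULift.{u} B) :=
  ⟨⟨fun x y => congrArg ULift.up (hf.1.map_inf x.down y.down),
    fun x y => congrArg ULift.up (hf.1.map_sup x.down y.down),
    fun x y => congrArg ULift.up (hf.1.map_mul x.down y.down),
    fun x y => congrArg ULift.up (hf.1.map_ldiv x.down y.down),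
    fun x y => congrArg ULift.up (hf.1.map_rdiv x.down y.down),
    congrArg ULift.up hf.1.map_one⟩,
    fun _ _ h => ULift.down_injective (hf.2 (congrArg ULift.down h))⟩

theorem Idempotent.ulift {A : Type} [ResiduatedLattice A] (h : Idempotent A) :
    Idempotent (ULift.{u} A) := fun x => congrArg ULift.up (h x.down)

theorem Chain.ulift {A : Type} [ResiduatedLattice A] (h : Chain A) :
    Chain (ULift.{u} A) := fun x y => h x.down y.down

/-! ### Three finite idempotent residuated chains -/

/-- A residuated chain on `Fin n` from the tables of its operations. -/
abbrev residuatedLatticeOfFin {n : ℕ} (mul ldiv rdiv : Fin n → Fin n → Fin n) (one : Fin n)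
    (mul_assoc : ∀ x y z, mul (mul x y) z = mul x (mul y z)) (one_mul : ∀ x, mul one x = x)
    (mul_one : ∀ x, mul x one = x) (le_ldiv_iff : ∀ x y z, y ≤ ldiv x z ↔ mul x y ≤ z)
    (le_rdiv_iff : ∀ x y z, x ≤ rdiv z y ↔ mul x y ≤ z) : ResiduatedLattice (Fin n) :=
  { (inferInstance : Lattice (Fin n)) with
    mul := mul
    one := one
    mul_assoc := mul_assoc
    one_mul := one_mul
    mul_one := mul_one
    ldiv := ldiv
    rdiv := rdiv
    le_ldiv_iff := le_ldiv_iff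
    le_rdiv_iff := le_rdiv_iff }

/-- The chain `⊥ < 1 < ⊤`. -/
def ThreeChain : Type := Fin 3

/-- The chain `⊥ < b < 1 < b' < ⊤` with `b * b' = b` and `b' * b = b'`. -/
def LeftChain : Type := Fin 5

/-- The chain `⊥ < c < 1 < c' < ⊤` with `c * c' = c'` and `c' * c = c`. -/
def RightChain : Type := Fin 5

instance : ResiduatedLattice ThreeChain :=
  residuatedLatticeOfFin (n := 3)
    ![![0, 0, 0], ![0, 1, 2], ![0, 2, 2]]
    ![![2, 2, 2], ![0, 1, 2], ![0, 0, 2]]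
    ![![2, 0, 0], ![2, 1, 0], ![2, 2, 2]]
    1 (by decide) (by decide) (by decide) (by decide) (by decide)
instance : Fintype ThreeChain := inferInstanceAs (Fintype (Fin 3))
instance : DecidableEq ThreeChain := inferInstanceAs (DecidableEq (Fin 3))
instance : DecidableLE ThreeChain := inferInstanceAs (DecidableLE (Fin 3))

instance : ResiduatedLattice LeftChain :=
  residuatedLatticeOfFin (n := 5)
    ![![0, 0, 0, 0, 0], ![0, 1, 1, 1, 4], ![0, 1, 2, 3, 4], ![0, 3, 3, 3, 4], ![0, 4, 4, 4, 4]]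
    ![![4, 4, 4, 4, 4], ![0, 3, 3, 3, 4], ![0, 1, 2, 3, 4], ![0, 0, 0, 3, 4], ![0, 0, 0, 0, 4]]
    ![![4, 0, 0, 0, 0], ![4, 2, 1, 1, 0], ![4, 2, 2, 1, 0], ![4, 3, 3, 3, 0], ![4, 4, 4, 4, 4]]
    2 (by decide) (by decide) (by decide) (by decide) (by decide)
instance : Fintype LeftChain := inferInstanceAs (Fintype (Fin 5))
instance : DecidableEq LeftChain := inferInstanceAs (DecidableEq (Fin 5))
instance : DecidableLE LeftChain := inferInstanceAs (DecidableLE (Fin 5))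

instance : ResiduatedLattice RightChain :=
  residuatedLatticeOfFin (n := 5)
    ![![0, 0, 0, 0, 0], ![0, 1, 1, 3, 4], ![0, 1, 2, 3, 4], ![0, 1, 3, 3, 4], ![0, 4, 4, 4, 4]]
    ![![4, 4, 4, 4, 4], ![0, 2, 2, 3, 4], ![0, 1, 2, 3, 4], ![0, 1, 1, 3, 4], ![0, 0, 0, 0, 4]]
    ![![4, 0, 0, 0, 0], ![4, 3, 1, 0, 0], ![4, 3, 2, 0, 0], ![4, 3, 3, 3, 0], ![4, 4, 4, 4, 4]]
    2 (by decide) (by decide) (by decide) (by decide) (by decide)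
instance : Fintype RightChain := inferInstanceAs (Fintype (Fin 5))
instance : DecidableEq RightChain := inferInstanceAs (DecidableEq (Fin 5))
instance : DecidableLE RightChain := inferInstanceAs (DecidableLE (Fin 5))

theorem ThreeChain.idempotent : Idempotent ThreeChain := by unfold Idempotent; decide
theorem LeftChain.idempotent : Idempotent LeftChain := by unfold Idempotent; decide
theorem RightChain.idempotent : Idempotent RightChain := by unfold Idempotent; decide

theorem ThreeChain.chain : Chain ThreeChain := le_total (α := Fin 3)
theorem LeftChain.chain : Chain LeftChain := le_total (α := Fin 5)
theorem RightChain.chain : Chain RightChain := le_total (α := Fin 5)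

/-- The least element of `ThreeChain`. -/
def ThreeChain.bot : ThreeChain := (0 : Fin 3)

/-- The inclusion of the bounds and the unit. -/
def ThreeChain.toLeft : ThreeChain → LeftChain := (![0, 2, 4] : Fin 3 → Fin 5)

/-- The inclusion of the bounds and the unit. -/
def ThreeChain.toRight : ThreeChain → RightChain := (![0, 2, 4] : Fin 3 → Fin 5)

theorem ThreeChain.isEmb_toLeft : IsEmb ThreeChain.toLeft :=
  ⟨⟨by decide, by decide, by decide, by decide, by decide, by decide⟩, by decide⟩

theorem ThreeChain.isEmb_toRight : IsEmb ThreeChain.toRight :=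
  ⟨⟨by decide, by decide, by decide, by decide, by decide, by decide⟩, by decide⟩

/-- The element `b` of `LeftChain`. -/
def LeftChain.b : LeftChain := (1 : Fin 5)

/-- The element `c'` of `RightChain`. -/
def RightChain.c' : RightChain := (3 : Fin 5)

theorem LeftChain.b_le_one : LeftChain.b ≤ 1 := by decide

/-- Here `b \ 1 = b'` and `b' \ 1 = ⊥`. -/
theorem LeftChain.ldiv_ldiv_b_one_le :
    ldiv (ldiv LeftChain.b 1) 1 ≤ ThreeChain.toLeft ThreeChain.bot := by
  decide

theorem LeftChain.ldiv_b_bot_le :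
    ldiv LeftChain.b (ThreeChain.toLeft ThreeChain.bot) ≤ ThreeChain.toLeft ThreeChain.bot := by
  decide

theorem RightChain.one_le_c' : 1 ≤ RightChain.c' := by decide

/-- Here `1 / c' = ⊥`, so `(1 / c') \ ⊥ = ⊤`, while `c' \ 1 = c`; neither `⊤` nor `c` lies below
`⊥`, and both disjuncts equal `⊥`. -/
theorem RightChain.not_one_le :
    ¬ 1 ≤ rdiv (ThreeChain.toRight ThreeChain.bot)
        (ldiv (rdiv 1 RightChain.c') (ThreeChain.toRight ThreeChain.bot)) ⊔
      rdiv (ThreeChain.toRight ThreeChain.bot) (ldiv RightChain.c' 1) := by decide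

/-! ### Failure of amalgamation and interpolation -/

theorem not_oneSidedAmalgamationProperty {K : RLClass.{u}}
    (hchain : ∀ (A : Type u) [ResiduatedLattice A], Idempotent A → Chain A → K A)
    (hK : ∀ (D : Type u) [ResiduatedLattice D], K D → Idempotent D ∧ HasConicCover D) :
    ¬ OneSidedAmalgamationProperty K := by
  intro H
  have hf := ThreeChain.isEmb_toLeft.ulift.{u}
  have hg := ThreeChain.isEmb_toRight.ulift.{u}
  obtain ⟨D, _, hD, g, h, hgHom, hh, hcomm⟩ := H _ _ _
    (hchain _ ThreeChain.idempotent.ulift ThreeChain.chain.ulift)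
    (hchain _ LeftChain.idempotent.ulift LeftChain.chain.ulift)
    (hchain _ RightChain.idempotent.ulift RightChain.chain.ulift) _ _ hf hg
  have hbot : g ⟨ThreeChain.toLeft ThreeChain.bot⟩ = h ⟨ThreeChain.toRight ThreeChain.bot⟩ :=
    congrFun hcomm ⟨ThreeChain.bot⟩
  obtain ⟨hidem, hcover⟩ := hK D hD
  have h1 := hgHom.monotone (x := ⟨LeftChain.b⟩) (y := 1) LeftChain.b_le_one
  have h2 := hgHom.monotone (x := ldiv (ldiv ⟨LeftChain.b⟩ 1) 1)
    (y := ⟨ThreeChain.toLeft ThreeChain.bot⟩) LeftChain.ldiv_ldiv_b_one_le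
  have h3 := hgHom.monotone (x := ldiv ⟨LeftChain.b⟩ ⟨ThreeChain.toLeft ThreeChain.bot⟩)
    (y := ⟨ThreeChain.toLeft ThreeChain.bot⟩) LeftChain.ldiv_b_bot_le
  have h4 := hh.1.monotone (x := 1) (y := ⟨RightChain.c'⟩) RightChain.one_le_c'
  rw [hgHom.map_one] at h1
  rw [hgHom.map_ldiv, hgHom.map_ldiv, hgHom.map_one, hbot] at h2
  rw [hgHom.map_ldiv, hbot] at h3
  rw [hh.1.map_one] at h4
  have h5 := one_le_of_hasConicCover hidem hcover h1 h2 h3 h4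
  -- Pulling the inequality back to `RightChain` is the one place that needs an embedding; the
  -- premises on `b` survive any homomorphism.
  rw [← hh.1.map_one, ← hh.1.map_rdiv, ← hh.1.map_ldiv, ← hh.1.map_ldiv, ← hh.1.map_rdiv,
    ← hh.1.map_rdiv, ← hh.1.map_sup, hh.le_iff] at h5
  exact RightChain.not_one_le h5

theorem AmalgamationProperty.oneSided {K : RLClass.{u}} (H : AmalgamationProperty K) :
    OneSidedAmalgamationProperty K := by
  intro A B C _ _ _ hA hB hC f g hf hg
  obtain ⟨D, i, hD, f', g', hf', hg', h⟩ := H A B C hA hB hC f g hf hg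
  exact ⟨D, i, hD, f', g', hf'.1, hg', h⟩

/-- Premises saying that `b`, the variable `0`, collapses everything to `z`, the variable `1`. -/
def collapsePremises : Set Term :=
  {.ldiv (.var 0) .one,
    .ldiv (.ldiv (.ldiv (.var 0) .one) .one) (.var 1),
    .ldiv (.ldiv (.var 0) (.var 1)) (.var 1)}

/-- The disjunction of `one_le_of_hasConicCover` at `z`, the variable `1`, and the join of `1`
with the variable `2`. -/
def collapseDisjunction : Term :=
  .sup (.rdiv (.var 1) (.ldiv (.rdiv .one (.sup (.var 2) .one)) (.var 1)))
    (.rdiv (.var 1) (.ldiv (.sup (.var 2) .one) .one))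

theorem varsOf_inter_vars_subset :
    varsOf collapsePremises ∩ collapseDisjunction.vars ⊆ {1} := by
  rintro n ⟨h1, h2⟩
  simp [varsOf, collapsePremises, collapseDisjunction, Term.vars] at h1 h2 ⊢
  omega

/-- An interpolant involves only the variable for `z`. At `z = ⊥` it holds in `LeftChain`, hence in
the common subalgebra `ThreeChain`, hence in `RightChain`, where the conclusion fails. -/
theorem not_deductiveInterpolation {K : RLClass.{u}}
    (hchain : ∀ (A : Type u) [ResiduatedLattice A], Idempotent A → Chain A → K A)
    (hK : ∀ (D : Type u) [ResiduatedLattice D], K D → Idempotent D ∧ HasConicCover D) :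
    ¬ DeductiveInterpolation (Entails K) := by
  intro H
  obtain ⟨Γ, hvars, hΓ, Δ, hΔ, -, hent⟩ := H collapsePremises collapseDisjunction
    ⟨collapsePremises, subset_rfl, by simp [collapsePremises], fun D _ hD a ha => by
      obtain ⟨hidem, hcover⟩ := hK D hD
      simp only [collapsePremises, Set.forall_mem_insert, Set.mem_singleton_iff, forall_eq,
        Term.eval, one_le_ldiv_iff] at ha
      -- The join with `1` makes `1 ≤ y` automatic; stating it as a premise would make the variable
      -- `2` shared.
      exact one_le_of_hasConicCover hidem hcover ha.1 ha.2.1 ha.2.2 le_sup_right⟩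
  have hf := ThreeChain.isEmb_toLeft.ulift.{u}
  have hg := ThreeChain.isEmb_toRight.ulift.{u}
  let zero : ULift.{u} ThreeChain := ⟨ThreeChain.bot⟩
  have hinterp : ∀ ψ ∈ Γ, 1 ≤ ψ.eval fun _ => zero := by
    intro ψ hψ
    obtain ⟨Δ', hΔ', -, hψent⟩ := hΓ ψ hψ
    have h := hψent (ULift.{u} LeftChain)
      (hchain _ LeftChain.idempotent.ulift LeftChain.chain.ulift)
      (fun n => if n = 0 then ⟨LeftChain.b⟩ else ULift.map ThreeChain.toLeft zero) fun χ hχ => by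
        rcases hΔ' hχ with rfl | rfl | rfl
        · exact one_le_ldiv_iff.2 LeftChain.b_le_one
        · exact one_le_ldiv_iff.2 LeftChain.ldiv_ldiv_b_one_le
        · exact one_le_ldiv_iff.2 LeftChain.ldiv_b_bot_le
    rw [ψ.eval_congr (a' := ULift.map ThreeChain.toLeft ∘ fun _ => zero), ← hf.1.map_eval,
      ← hf.1.map_one, hf.le_iff] at h
    · exact h
    · intro n hn
      have : n = 1 := varsOf_inter_vars_subset (hvars (Set.mem_biUnion hψ hn))
      simp [this]
  have h := hent (ULift.{u} RightChain)
    (hchain _ RightChain.idempotent.ulift RightChain.chain.ulift)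
    (fun n => if n = 2 then ⟨RightChain.c'⟩ else ULift.map ThreeChain.toRight zero) fun ψ hψ => by
      rw [ψ.eval_congr (a' := ULift.map ThreeChain.toRight ∘ fun _ => zero), ← hg.1.map_eval,
        ← hg.1.map_one, hg.le_iff]
      · exact hinterp ψ (hΔ hψ)
      · intro n hn
        have : n = 1 := varsOf_inter_vars_subset (hvars (Set.mem_biUnion (hΔ hψ) hn))
        simp [this]
  -- The value `c' ⊔ 1` of the join computes to `c'`.
  exact RightChain.not_one_le h

end ResLat

theorem theoremt :
    -- the one-sided amalgamation property and the amalgamation property fail for chains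
    ¬ ResLat.OneSidedAmalgamationProperty ResLat.IdempotentChains.{u} ∧
    ¬ ResLat.AmalgamationProperty ResLat.IdempotentChains.{u} ∧
    -- and for the finitely subdirectly irreducible conic idempotent residuated lattices
    ¬ ResLat.OneSidedAmalgamationProperty ResLat.FSIConicIdempotent.{u} ∧
    ¬ ResLat.AmalgamationProperty ResLat.FSIConicIdempotent.{u} ∧
    -- the amalgamation property fails for the two varieties
    ¬ ResLat.AmalgamationProperty ResLat.SemilinearIdempotent.{u} ∧
    ¬ ResLat.AmalgamationProperty ResLat.SemiconicIdempotent.{u} ∧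
    -- the two logics lack deductive interpolation
    ¬ ResLat.DeductiveInterpolation ResLat.SIL.{u} ∧
    ¬ ResLat.DeductiveInterpolation ResLat.CIL.{u} := by
  have chains := @ResLat.not_oneSidedAmalgamationProperty ResLat.IdempotentChains.{u}
    (fun _ _ hi hc => ⟨hi, hc⟩) (fun _ _ h => ⟨h.1, h.2.conic.hasConicCover⟩)
  have fsi := @ResLat.not_oneSidedAmalgamationProperty ResLat.FSIConicIdempotent.{u}
    (fun _ _ hi hc => ⟨hc.fsi, hc.conic, hi⟩) (fun _ _ h => ⟨h.2.2, h.2.1.hasConicCover⟩)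
  have slChain : ∀ (A : Type u) [ResLat.ResiduatedLattice A],
      ResLat.Idempotent A → ResLat.Chain A → ResLat.SemilinearIdempotent A := fun _ _ hi hc => ⟨hc.semilinear, hi⟩
  have slCover : ∀ (D : Type u) [ResLat.ResiduatedLattice D], ResLat.SemilinearIdempotent D →
      ResLat.Idempotent D ∧ ResLat.HasConicCover D := fun _ _ h => ⟨h.2, h.1.hasConicCover⟩
  have scChain : ∀ (A : Type u) [ResLat.ResiduatedLattice A],
      ResLat.Idempotent A → ResLat.Chain A → ResLat.SemiconicIdempotent A := fun _ _ hi hc => ⟨hc.conic.semiconic, hi⟩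
  have scCover : ∀ (D : Type u) [ResLat.ResiduatedLattice D], ResLat.SemiconicIdempotent D →
      ResLat.Idempotent D ∧ ResLat.HasConicCover D := fun _ _ h => ⟨h.2, h.1.hasConicCover⟩
  exact ⟨chains, fun h => chains h.oneSided, fsi, fun h => fsi h.oneSided,
    fun h => ResLat.not_oneSidedAmalgamationProperty slChain slCover h.oneSided,
    fun h => ResLat.not_oneSidedAmalgamationProperty scChain scCover h.oneSided,
    ResLat.not_deductiveInterpolation slChain slCover,
    ResLat.not_deductiveInterpolation scChain scCover⟩
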